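/- Theorem 4.1. Let $\mathcal{H}$ be a complex Hilbert space with an orthogonal decomposition $\mathcal{H}=\mathcal{H}_0\oplus\mathcal{H}_1$ into closed subspaces, and let $T$ be a bounded linear operator on $\mathcal{H}$ whose block matrix with respect to this decomposition is $$T=\begin{pmatrix}C_0&C\\0&C_1\end{pmatrix},$$ where $C_i$ is a contraction on $\mathcal{H}_i$ ($\|C_i\|\le 1$, $i=0,1$) and $C:\mathcal{H}_1\to\mathcal{H}_0$ is a bounded linear operator with $CC_1=C_0C$. Then $T$ has a $3$-isometric lifting of the form isometry plus commuting nilpotent of order $2$: there are a Hilbert space $\mathcal{K}\supset\mathcal{H}$ (containing $\mathcal{H}$ as a closed subspace, up to an isometric identification) and a bounded linear operator $S$ on $\mathcal{K}$ such that 1. $S$ is a lifting of $T$, that is, $TP_{\mathcal{H}}=P_{\mathcal{H}}S$, where $P_{\mathcal{H}}$ is the orthogonal projection of $\mathcal{K}$ onto $\mathcal{H}$; 2. $S$ is $3$-isometric, that is, $\sum_{j=0}^{3}(-1)^j\binom{3}{j}S^{*j}S^j=0$; 3. $S=V+Q$ for some bounded linear operators $V,Q$ on $\mathcal{K}$, where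 $V$ is an isometry, $Q^2=0$ and $VQ=QV$. -/

import Mathlib

universe u

/-- `S` is `m`-isometric (intended for `m ≥ 1`):
`∑_{j=0}^m (-1)^j (m choose j) S^{*j} S^j = 0`. -/
def IsMIsometric {K : Type*} [NormedAddCommGroup K] [InnerProductSpace ℂ K] [CompleteSpace K]
    (m : ℕ) (S : K →L[ℂ] K) : Prop :=
  ∑ j ∈ Finset.range (m + 1),
    ((-1 : ℂ) ^ j * (m.choose j : ℂ)) • (ContinuousLinearMap.adjoint S ^ j * S ^ j) = 0

/-- The inclusion of `H` in a larger Hilbert space `K` is given by an isometric embedding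
`J : H → K`.  This is the orthogonal projection `P_H` of `K` onto (the copy of) `H`, with values
in `H`: it is the adjoint of the inclusion. -/
noncomputable def projOnto {H K : Type*}
    [NormedAddCommGroup H] [InnerProductSpace ℂ H] [CompleteSpace H]
    [NormedAddCommGroup K] [InnerProductSpace ℂ K] [CompleteSpace K]
    (J : H →ₗᵢ[ℂ] K) : K →L[ℂ] H :=
  ContinuousLinearMap.adjoint J.toContinuousLinearMap

/-- `projOnto J` is the orthogonal projection: `J (P k)` lies in the copy of `H`, and
`k - J (P k)` is orthogonal to it. -/
theorem projOnto_spec {H K : Type*}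
    [NormedAddCommGroup H] [InnerProductSpace ℂ H] [CompleteSpace H]
    [NormedAddCommGroup K] [InnerProductSpace ℂ K] [CompleteSpace K]
    (J : H →ₗᵢ[ℂ] K) (k : K) (h : H) : inner ℂ (k - J (projOnto J k)) (J h) = 0 := by
  rw [inner_sub_left, J.inner_map_map, projOnto, ContinuousLinearMap.adjoint_inner_left]
  simp

/-- `S` on `K ⊇ H` is a lifting of `T` on `H`: `T P_H = P_H S`. -/
def IsLifting {H K : Type*}
    [NormedAddCommGroup H] [InnerProductSpace ℂ H] [CompleteSpace H]
    [NormedAddCommGroup K] [InnerProductSpace ℂ K] [CompleteSpace K]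
    (J : H →ₗᵢ[ℂ] K) (T : H →L[ℂ] H) (S : K →L[ℂ] K) : Prop :=
  T ∘L projOnto J = projOnto J ∘L S

/-- With respect to `H = H₀ ⊕ H₀ᗮ`, the operator `T` has the block matrix `(C₀ C; 0 C₁)`. -/
def HasUpperBlockForm {H : Type*} [NormedAddCommGroup H] [InnerProductSpace ℂ H]
    (T : H →L[ℂ] H) (H₀ : Submodule ℂ H)
    (C₀ : H₀ →L[ℂ] H₀) (C : H₀ᗮ →L[ℂ] H₀) (C₁ : H₀ᗮ →L[ℂ] H₀ᗮ) : Prop :=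
  ∀ (x : H₀) (y : H₀ᗮ), T ((x : H) + (y : H)) = ((C₀ x + C y : H₀) : H) + ((C₁ y : H₀ᗮ) : H)

/-! Suppose $C_0$, $C_1$ have isometric liftings $V_0$, $V_1$ and $C$ lifts to $X$ with $XV_1=V_0X$.
Then $V=V_0\oplus V_1$ and $Q=\begin{pmatrix}0&X\\0&0\end{pmatrix}$ commute, $Q^2=0$, and $V+Q$
lifts $T$.

To build $X$ (`exists_intertwining_lifting_of_norm_le_one`), scale $C$ to a contraction and take
defect operators $D_0,D_1,D$ of $C_0,C_1,C$. Since $CC_1=C_0C$,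
$\|D_0Cx\|^2+\|Dx\|^2=\|x\|^2-\|C_0Cx\|^2=\|DC_1x\|^2+\|D_1x\|^2$, so
$(D_0Cx,Dx)\mapsto(DC_1x,D_1x)$ extends to an isometry $U$ into a larger space. From $U$ one gets an
isometry $W_0$ that matches $W_1=(C_1,D_1,0)$ along $x\mapsto(Cx,Dx)$; shifting the surplus
coordinates into $\ell^2$ turns $W_0,W_1$ into $V_0,V_1$. -/

open ContinuousLinearMap in
/-- A contraction has a defect operator. -/
theorem exists_defect {E F : Type*} [NormedAddCommGroup E] [InnerProductSpace ℂ E] [CompleteSpace E]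
    [NormedAddCommGroup F] [InnerProductSpace ℂ F] [CompleteSpace F]
    (A : E →L[ℂ] F) (hA : ‖A‖ ≤ 1) :
    ∃ D : E →L[ℂ] E, ∀ x, ‖D x‖ ^ 2 = ‖x‖ ^ 2 - ‖A x‖ ^ 2 := by
  have key : ∀ x, (inner ℂ ((1 - adjoint A ∘L A) x) x : ℂ) = ((‖x‖ ^ 2 - ‖A x‖ ^ 2 : ℝ) : ℂ) := by
    intro x
    rw [sub_apply, inner_sub_left, comp_apply, adjoint_inner_left]
    simp [inner_self_eq_norm_sq_to_K]
  have hpos : (0 : E →L[ℂ] E) ≤ 1 - adjoint A ∘L A := by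
    rw [nonneg_iff_isPositive, isPositive_iff_complex]
    intro x
    rw [key x, RCLike.re_to_complex, Complex.ofReal_re]
    refine ⟨rfl, ?_⟩
    have : ‖A x‖ ≤ ‖x‖ := by simpa using A.le_of_opNorm_le hA x
    nlinarith [norm_nonneg (A x), norm_nonneg x]
  refine ⟨CFC.sqrt (1 - adjoint A ∘L A), fun x => ?_⟩
  have hs : adjoint (CFC.sqrt (1 - adjoint A ∘L A)) = CFC.sqrt (1 - adjoint A ∘L A) :=
    (CFC.sqrt_nonneg (1 - adjoint A ∘L A)).isSelfAdjoint
  have h2 := key x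
  rw [← CFC.sqrt_mul_sqrt_self _ hpos] at h2
  change inner ℂ ((CFC.sqrt (1 - adjoint A ∘L A)) ((CFC.sqrt (1 - adjoint A ∘L A)) x)) x = _ at h2
  nth_rw 1 [← hs] at h2
  rw [adjoint_inner_left, inner_self_eq_norm_sq_to_K] at h2
  refine Complex.ofReal_injective ?_
  rw [← h2]
  simp

/-- The pairing of two operators into the Hilbert direct sum. -/
noncomputable def hilbertPair {E F G : Type*} [NormedAddCommGroup E] [InnerProductSpace ℂ E]
    [NormedAddCommGroup F] [InnerProductSpace ℂ F] [NormedAddCommGroup G] [InnerProductSpace ℂ G]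
    (f : E →L[ℂ] F) (g : E →L[ℂ] G) : E →L[ℂ] WithLp 2 (F × G) :=
  (WithLp.prodContinuousLinearEquiv 2 ℂ F G).symm.toContinuousLinearMap ∘L f.prod g

@[simp]
theorem hilbertPair_apply {E F G : Type*} [NormedAddCommGroup E] [InnerProductSpace ℂ E]
    [NormedAddCommGroup F] [InnerProductSpace ℂ F] [NormedAddCommGroup G] [InnerProductSpace ℂ G]
    (f : E →L[ℂ] F) (g : E →L[ℂ] G) (x : E) : hilbertPair f g x = WithLp.toLp 2 (f x, g x) := rfl

/-- If `‖p x‖ = ‖q x‖` for all `x`, then `p x ↦ q x` extends to an isometry of the whole space,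
after enlarging the codomain. -/
theorem exists_isometry_of_norm_eq {E G G' : Type*}
    [NormedAddCommGroup E] [InnerProductSpace ℂ E]
    [NormedAddCommGroup G] [InnerProductSpace ℂ G] [CompleteSpace G]
    [NormedAddCommGroup G'] [InnerProductSpace ℂ G'] [CompleteSpace G']
    (p : E →L[ℂ] G) (q : E →L[ℂ] G') (h : ∀ x, ‖p x‖ = ‖q x‖) :
    ∃ U : G →L[ℂ] WithLp 2 (G' × G), (∀ y, ‖U y‖ = ‖y‖) ∧
      ∀ x, U (p x) = WithLp.toLp 2 (q x, 0) := by
  set M : Submodule ℂ G := p.range.topologicalClosure with hM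
  have hpM : ∀ x, p x ∈ M := fun x =>
    Submodule.le_topologicalClosure _ (LinearMap.mem_range_self p.toLinearMap x)
  let e : E →ₗ[ℂ] M := p.toLinearMap.codRestrict M hpM
  have he : DenseRange e := by
    intro y
    rw [closure_subtype]
    have hy : (y : G) ∈ closure (Set.range p) := y.2
    convert! hy using 2
    ext z
    constructor
    · rintro ⟨_, ⟨x, rfl⟩, rfl⟩
      exact ⟨x, rfl⟩
    · rintro ⟨x, rfl⟩
      exact ⟨e x, ⟨x, rfl⟩, rfl⟩
  -- This bound makes `q` factor through `e` even when `p` is not injective.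
  have hnorm : ∀ x, ‖q.toLinearMap x‖ ≤ 1 * ‖e x‖ := fun x => by
    rw [one_mul]; exact (h x).ge
  let u : M →L[ℂ] G' := q.toLinearMap.extendOfNorm e
  have hu : ∀ x, u (e x) = q x := LinearMap.extendOfNorm_eq he ⟨1, hnorm⟩
  have hun : ∀ y, ‖u y‖ = ‖y‖ := fun y => by
    refine he.induction (P := fun y => ‖u y‖ = ‖y‖) ?_
      (isClosed_eq u.continuous.norm continuous_norm) y
    rintro _ ⟨x, rfl⟩
    rw [hu]; exact (h x).symm
  -- The component orthogonal to `M` is stored in the extra summand `G`, so no comparison of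
  -- codimensions is needed.
  refine ⟨hilbertPair (u ∘L M.orthogonalProjectionOnto)
    (ContinuousLinearMap.id ℂ G - M.subtypeL ∘L M.orthogonalProjectionOnto), fun y => ?_, fun x => ?_⟩
  · rw [← sq_eq_sq₀ (norm_nonneg _) (norm_nonneg _), WithLp.prod_norm_sq_eq_of_L2,
      Submodule.norm_sq_eq_add_norm_sq_projection y M]
    simp [hun]
  · have : M.orthogonalProjectionOnto (p x) = e x :=
      Submodule.orthogonalProjectionOnto_mem_subspace_eq_self (⟨p x, hpM x⟩ : M)
    have h2 : ((e x : M) : G) = p x := rfl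
    simp [this, hu, h2]

/-- Prepend a vector to a square-summable sequence. -/
def seqCons {F : Type*} (a : F) (f : ℕ → F) : ℕ → F
  | 0 => a
  | n + 1 => f n

theorem memℓp_seqCons {F : Type*} [NormedAddCommGroup F] (a : F) (f : lp (fun _ : ℕ => F) 2) :
    Memℓp (seqCons a f) 2 := by
  have h := (lp.memℓp f).summable (by simp)
  refine memℓp_gen ?_
  rw [← summable_nat_add_iff 1]
  exact h

/-- Prepending a vector, as an isometry `F ⊕ ℓ²(F) → ℓ²(F)`. -/
noncomputable def lpCons (F : Type*) [NormedAddCommGroup F] [InnerProductSpace ℂ F] :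
    WithLp 2 (F × lp (fun _ : ℕ => F) 2) →ₗᵢ[ℂ] lp (fun _ : ℕ => F) 2 where
  toFun x := ⟨seqCons x.fst x.snd, memℓp_seqCons _ _⟩
  map_add' x y := by
    ext n
    cases n <;> rfl
  map_smul' c x := by
    ext n
    cases n <;> rfl
  norm_map' x := by
    rw [← sq_eq_sq₀ (norm_nonneg _) (norm_nonneg _), WithLp.prod_norm_sq_eq_of_L2]
    have h1 := lp.hasSum_norm (p := 2) (by simp) x.snd
    have h2 := lp.hasSum_norm (p := 2) (by simp)
      (⟨seqCons x.fst x.snd, memℓp_seqCons _ _⟩ : lp (fun _ : ℕ => F) 2)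
    rw [← hasSum_nat_add_iff' 1] at h2
    have h3 := h2.unique h1
    simp only [ENNReal.toReal_ofNat, Real.rpow_ofNat, Finset.range_one, Finset.sum_singleton] at h3
    change _ - ‖x.fst‖ ^ 2 = _ at h3
    exact (sub_eq_iff_eq_add'.1 h3)

/-! ### Isometric dilation by a shift -/

section Shift

variable {A B F : Type*} [NormedAddCommGroup A] [InnerProductSpace ℂ A]
  [NormedAddCommGroup B] [InnerProductSpace ℂ B] [NormedAddCommGroup F] [InnerProductSpace ℂ F]

/-- The operator `(a, f₀, f₁, …) ↦ ((W a).1, (W a).2, f₀, f₁, …)` on `A ⊕ ℓ²(F)`. -/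
noncomputable def shiftDilation (W : A →L[ℂ] WithLp 2 (A × F)) :
    WithLp 2 (A × lp (fun _ : ℕ => F) 2) →L[ℂ] WithLp 2 (A × lp (fun _ : ℕ => F) 2) :=
  hilbertPair (WithLp.fstL 2 ℂ A F ∘L W ∘L WithLp.fstL 2 ℂ _ _)
    ((lpCons F).toContinuousLinearMap ∘L
      hilbertPair (WithLp.sndL 2 ℂ A F ∘L W ∘L WithLp.fstL 2 ℂ _ _) (WithLp.sndL 2 ℂ _ _))

theorem shiftDilation_apply (W : A →L[ℂ] WithLp 2 (A × F))
    (x : WithLp 2 (A × lp (fun _ : ℕ => F) 2)) :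
    shiftDilation W x =
      WithLp.toLp 2 ((W x.fst).fst, lpCons F (WithLp.toLp 2 ((W x.fst).snd, x.snd))) := rfl

theorem norm_shiftDilation_apply (W : A →L[ℂ] WithLp 2 (A × F)) (hW : ∀ a, ‖W a‖ = ‖a‖)
    (x : WithLp 2 (A × lp (fun _ : ℕ => F) 2)) : ‖shiftDilation W x‖ = ‖x‖ := by
  have h := congrArg (· ^ 2) (hW x.fst)
  simp only [WithLp.prod_norm_sq_eq_of_L2] at h
  rw [← sq_eq_sq₀ (norm_nonneg _) (norm_nonneg _), shiftDilation_apply]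
  simp only [WithLp.prod_norm_sq_eq_of_L2, WithLp.toLp_fst, WithLp.toLp_snd,
    LinearIsometry.norm_map]
  linarith

/-- The operator `(a, f) ↦ (X a, f)` from `A ⊕ ℓ²(F)` to `B ⊕ ℓ²(F)`. -/
noncomputable def mapFst (X : A →L[ℂ] B) :
    WithLp 2 (A × lp (fun _ : ℕ => F) 2) →L[ℂ] WithLp 2 (B × lp (fun _ : ℕ => F) 2) :=
  hilbertPair (X ∘L WithLp.fstL 2 ℂ _ _) (WithLp.sndL 2 ℂ _ _)

theorem mapFst_apply (X : A →L[ℂ] B) (x : WithLp 2 (A × lp (fun _ : ℕ => F) 2)) :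
    mapFst X x = WithLp.toLp 2 (X x.fst, x.snd) := rfl

/-- Both shifts use the same `F`, so the identity on the tails intertwines them and only the first
step needs checking. -/
theorem mapFst_shiftDilation (W : A →L[ℂ] WithLp 2 (A × F)) (W' : B →L[ℂ] WithLp 2 (B × F))
    (X : A →L[ℂ] B) (h : ∀ a, W' (X a) = WithLp.toLp 2 (X (W a).fst, (W a).snd))
    (x : WithLp 2 (A × lp (fun _ : ℕ => F) 2)) :
    mapFst X (shiftDilation W x) = shiftDilation W' (mapFst X x) := by
  simp [mapFst_apply, shiftDilation_apply, h]

end Shift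

section Projections

variable {A B C : Type*} [NormedAddCommGroup A] [InnerProductSpace ℂ A] [CompleteSpace A]
  [NormedAddCommGroup B] [InnerProductSpace ℂ B] [CompleteSpace B]
  [NormedAddCommGroup C] [InnerProductSpace ℂ C] [CompleteSpace C]

theorem projOnto_eq_of_inner (J : A →ₗᵢ[ℂ] B) (P : B →L[ℂ] A)
    (h : ∀ b a, inner ℂ (P b) a = inner ℂ b (J a)) : projOnto J = P := by
  ext b
  refine ext_inner_right ℂ fun a => ?_
  rw [h, projOnto, ContinuousLinearMap.adjoint_inner_left]
  rfl

theorem inner_projOnto (J : A →ₗᵢ[ℂ] B) (b : B) (a : A) :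
    inner ℂ (projOnto J b) a = inner ℂ b (J a) := by
  rw [projOnto, ContinuousLinearMap.adjoint_inner_left]
  rfl

/-- The embedding of the first summand in a Hilbert direct sum. -/
noncomputable def embFst (A B : Type*) [NormedAddCommGroup A] [InnerProductSpace ℂ A]
    [NormedAddCommGroup B] [InnerProductSpace ℂ B] : A →ₗᵢ[ℂ] WithLp 2 (A × B) where
  toLinearMap := (hilbertPair (ContinuousLinearMap.id ℂ A) (0 : A →L[ℂ] B)).toLinearMap
  norm_map' x := by
    rw [← sq_eq_sq₀ (norm_nonneg _) (norm_nonneg _), WithLp.prod_norm_sq_eq_of_L2]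
    simp

theorem embFst_apply {A B : Type*} [NormedAddCommGroup A] [InnerProductSpace ℂ A]
    [NormedAddCommGroup B] [InnerProductSpace ℂ B] (a : A) : embFst A B a = WithLp.toLp 2 (a, 0) := rfl

theorem projOnto_embFst : projOnto (embFst A B) = WithLp.fstL 2 ℂ A B :=
  projOnto_eq_of_inner _ _ fun b a => by simp [embFst_apply, WithLp.prod_inner_apply]

theorem projOnto_comp (J : A →ₗᵢ[ℂ] B) (J' : B →ₗᵢ[ℂ] C) :
    projOnto (J'.comp J) = projOnto J ∘L projOnto J' :=
  projOnto_eq_of_inner _ _ fun b a => by simp [inner_projOnto]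

end Projections

/-! ### Intertwining lifting -/

/-- Intertwining lifting for a contractive intertwiner: contractions `C₀`, `C₁` with `C C₁ = C₀ C`
have isometric liftings `V₀`, `V₁` and `C` lifts to an operator `X` with `X V₁ = V₀ X`. -/
theorem exists_intertwining_lifting_of_norm_le_one {E₀ E₁ : Type u}
    [NormedAddCommGroup E₀] [InnerProductSpace ℂ E₀] [CompleteSpace E₀]
    [NormedAddCommGroup E₁] [InnerProductSpace ℂ E₁] [CompleteSpace E₁]
    (C₀ : E₀ →L[ℂ] E₀) (C : E₁ →L[ℂ] E₀) (C₁ : E₁ →L[ℂ] E₁)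
    (hC₀ : ‖C₀‖ ≤ 1) (hC₁ : ‖C₁‖ ≤ 1) (hC : ‖C‖ ≤ 1) (hCC : ∀ x, C (C₁ x) = C₀ (C x)) :
    ∃ (K₀ K₁ : Type u)
      (_ : NormedAddCommGroup K₀) (_ : InnerProductSpace ℂ K₀) (_ : CompleteSpace K₀)
      (_ : NormedAddCommGroup K₁) (_ : InnerProductSpace ℂ K₁) (_ : CompleteSpace K₁)
      (J₀ : E₀ →ₗᵢ[ℂ] K₀) (J₁ : E₁ →ₗᵢ[ℂ] K₁)
      (V₀ : K₀ →L[ℂ] K₀) (V₁ : K₁ →L[ℂ] K₁) (X : K₁ →L[ℂ] K₀),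
      (∀ k, ‖V₀ k‖ = ‖k‖) ∧ (∀ k, ‖V₁ k‖ = ‖k‖) ∧ (∀ k, X (V₁ k) = V₀ (X k)) ∧
      (∀ k, projOnto J₀ (V₀ k) = C₀ (projOnto J₀ k)) ∧
      (∀ k, projOnto J₁ (V₁ k) = C₁ (projOnto J₁ k)) ∧
      (∀ k, projOnto J₀ (X k) = C (projOnto J₁ k)) := by
  obtain ⟨D₀, hD₀⟩ := exists_defect C₀ hC₀
  obtain ⟨D₁, hD₁⟩ := exists_defect C₁ hC₁
  obtain ⟨D, hD⟩ := exists_defect C hC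
  obtain ⟨U, hU, hUp⟩ := exists_isometry_of_norm_eq
    (hilbertPair (D₀ ∘L C) D) (hilbertPair (D ∘L C₁) D₁) fun x => by
      rw [← sq_eq_sq₀ (norm_nonneg _) (norm_nonneg _)]
      simp only [WithLp.prod_norm_sq_eq_of_L2, hilbertPair_apply, WithLp.toLp_fst,
        WithLp.toLp_snd, ContinuousLinearMap.comp_apply, hD₀, hD₁, hD, hCC]
      ring
  let fst₀ := WithLp.fstL 2 ℂ E₀ E₁
  let Y : WithLp 2 (E₀ × E₁) →L[ℂ] WithLp 2 (WithLp 2 (E₁ × E₁) × WithLp 2 (E₀ × E₁)) :=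
    U ∘L hilbertPair (D₀ ∘L fst₀) (WithLp.sndL 2 ℂ E₀ E₁)
  -- The first coordinate of $U(D_0a,b)$ stays in the base space, where it will equal $DC_1x$; the
  -- others feed the shift.
  let W₀ : WithLp 2 (E₀ × E₁) →L[ℂ]
      WithLp 2 (WithLp 2 (E₀ × E₁) × WithLp 2 (E₁ × WithLp 2 (E₀ × E₁))) :=
    hilbertPair (hilbertPair (C₀ ∘L fst₀) (WithLp.fstL 2 ℂ E₁ E₁ ∘L WithLp.fstL 2 ℂ _ _ ∘L Y))
      (hilbertPair (WithLp.sndL 2 ℂ E₁ E₁ ∘L WithLp.fstL 2 ℂ _ _ ∘L Y) (WithLp.sndL 2 ℂ _ _ ∘L Y))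
  -- The zero pads $D_1$ to the shift space of `W₀`.
  let W₁ : E₁ →L[ℂ] WithLp 2 (E₁ × WithLp 2 (E₁ × WithLp 2 (E₀ × E₁))) :=
    hilbertPair C₁ (hilbertPair D₁ 0)
  have hW₀ : ∀ x, ‖W₀ x‖ = ‖x‖ := fun x => by
    have h := congrArg (· ^ 2) (hU (WithLp.toLp 2 (D₀ x.fst, x.snd)))
    simp only [WithLp.prod_norm_sq_eq_of_L2, WithLp.toLp_fst, WithLp.toLp_snd, hD₀] at h
    rw [← sq_eq_sq₀ (norm_nonneg _) (norm_nonneg _)]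
    simp only [W₀, Y, fst₀, WithLp.prod_norm_sq_eq_of_L2, hilbertPair_apply, WithLp.toLp_fst,
      WithLp.toLp_snd, ContinuousLinearMap.comp_apply, WithLp.fstL_apply, WithLp.sndL_apply]
    linarith
  have hW₁ : ∀ x, ‖W₁ x‖ = ‖x‖ := fun x => by
    rw [← sq_eq_sq₀ (norm_nonneg _) (norm_nonneg _)]
    simp [W₁, WithLp.prod_norm_sq_eq_of_L2, hD₁]
  have hX : ∀ a, W₀ (hilbertPair C D a) =
      WithLp.toLp 2 (hilbertPair C D (W₁ a).fst, (W₁ a).snd) := fun a => by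
    have h := hUp a
    simp only [hilbertPair_apply, ContinuousLinearMap.comp_apply] at h
    simp [W₀, W₁, Y, fst₀, h, hCC]
  refine ⟨_, _, inferInstance, inferInstance, inferInstance, inferInstance, inferInstance,
    inferInstance, (embFst _ _).comp (embFst E₀ E₁), embFst _ _, shiftDilation W₀,
    shiftDilation W₁, mapFst (hilbertPair C D), norm_shiftDilation_apply W₀ hW₀,
    norm_shiftDilation_apply W₁ hW₁, mapFst_shiftDilation W₁ W₀ _ hX, ?_, ?_, ?_⟩ <;> intro k <;>
  simp [projOnto_comp, projOnto_embFst, shiftDilation_apply, mapFst_apply, W₀, W₁, fst₀]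

/-- Intertwining lifting: contractions `C₀`, `C₁` with `C C₁ = C₀ C` have isometric liftings `V₀`,
`V₁` and `C` lifts to an operator `X` with `X V₁ = V₀ X`. -/
theorem exists_intertwining_lifting {E₀ E₁ : Type u}
    [NormedAddCommGroup E₀] [InnerProductSpace ℂ E₀] [CompleteSpace E₀]
    [NormedAddCommGroup E₁] [InnerProductSpace ℂ E₁] [CompleteSpace E₁]
    (C₀ : E₀ →L[ℂ] E₀) (C : E₁ →L[ℂ] E₀) (C₁ : E₁ →L[ℂ] E₁)
    (hC₀ : ‖C₀‖ ≤ 1) (hC₁ : ‖C₁‖ ≤ 1) (hCC : ∀ x, C (C₁ x) = C₀ (C x)) :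
    ∃ (K₀ K₁ : Type u)
      (_ : NormedAddCommGroup K₀) (_ : InnerProductSpace ℂ K₀) (_ : CompleteSpace K₀)
      (_ : NormedAddCommGroup K₁) (_ : InnerProductSpace ℂ K₁) (_ : CompleteSpace K₁)
      (J₀ : E₀ →ₗᵢ[ℂ] K₀) (J₁ : E₁ →ₗᵢ[ℂ] K₁)
      (V₀ : K₀ →L[ℂ] K₀) (V₁ : K₁ →L[ℂ] K₁) (X : K₁ →L[ℂ] K₀),
      (∀ k, ‖V₀ k‖ = ‖k‖) ∧ (∀ k, ‖V₁ k‖ = ‖k‖) ∧ (∀ k, X (V₁ k) = V₀ (X k)) ∧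
      (∀ k, projOnto J₀ (V₀ k) = C₀ (projOnto J₀ k)) ∧
      (∀ k, projOnto J₁ (V₁ k) = C₁ (projOnto J₁ k)) ∧
      (∀ k, projOnto J₀ (X k) = C (projOnto J₁ k)) := by
  -- Scaling by $\|C\|+1$ also covers $C=0$.
  have hc : (0 : ℝ) < ‖C‖ + 1 := by positivity
  have hc' : ((‖C‖ + 1 : ℝ) : ℂ) ≠ 0 := by exact_mod_cast hc.ne'
  obtain ⟨K₀, K₁, _, _, _, _, _, _, J₀, J₁, V₀, V₁, X, h₀, h₁, hX, hP₀, hP₁, hPX⟩ :=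
    exists_intertwining_lifting_of_norm_le_one C₀ (((‖C‖ + 1 : ℝ) : ℂ)⁻¹ • C) C₁ hC₀ hC₁
      (by
        rw [norm_smul, norm_inv, Complex.norm_real, Real.norm_of_nonneg hc.le,
          inv_mul_le_iff₀ hc]
        linarith)
      (fun x => by simp [hCC])
  refine ⟨K₀, K₁, _, _, inferInstance, _, _, inferInstance, J₀, J₁, V₀, V₁,
    ((‖C‖ + 1 : ℝ) : ℂ) • X, h₀, h₁, fun k => ?_, hP₀, hP₁, fun k => ?_⟩
  · rw [smul_apply, smul_apply, hX, map_smul]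
  · rw [smul_apply, map_smul, hPX, smul_apply,
      smul_inv_smul₀ hc']

/-! ### Assembling the 3-isometry -/

/-- An isometry plus a commuting nilpotent of order two is `3`-isometric. -/
theorem isMIsometric_three_of_isometry_add_nilpotent {K : Type*} [NormedAddCommGroup K]
    [InnerProductSpace ℂ K] [CompleteSpace K] (V Q : K →L[ℂ] K)
    (hV : ContinuousLinearMap.adjoint V * V = 1) (hQ : Q * Q = 0) (hVQ : V * Q = Q * V) :
    IsMIsometric 3 (V + Q) := by
  have hVQ' : ContinuousLinearMap.adjoint Q * ContinuousLinearMap.adjoint V =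
      ContinuousLinearMap.adjoint V * ContinuousLinearMap.adjoint Q := by
    simpa only [ContinuousLinearMap.star_eq_adjoint, star_mul] using congrArg star hVQ
  have hQ' : ContinuousLinearMap.adjoint Q * ContinuousLinearMap.adjoint Q = 0 := by
    simpa only [ContinuousLinearMap.star_eq_adjoint, star_mul, star_zero] using congrArg star hQ
  rw [IsMIsometric, map_add]
  generalize ContinuousLinearMap.adjoint V = a at *
  generalize ContinuousLinearMap.adjoint Q = q at *
  have r1 : ∀ x, a * (V * x) = x := fun x => by rw [← mul_assoc, hV, one_mul]
  have r3 : ∀ x, q * (a * x) = a * (q * x) := fun x => by rw [← mul_assoc, hVQ', mul_assoc]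
  -- With $S=V+Q$, $S^j=V^j+jV^{j-1}Q$, so $S^{*j}S^j=I+j(V^*Q+Q^*V)+j^2Q^*Q$ is quadratic in $j$
  -- and its third difference vanishes.
  have s2 : (V + Q) ^ 2 = V * V + (2 : ℂ) • (V * Q) := by
    rw [pow_two, two_smul]
    simp only [mul_add, add_mul, hQ, ← hVQ]
    abel
  have s3 : (V + Q) ^ 3 = V * (V * V) + (3 : ℂ) • (V * (V * Q)) := by
    rw [pow_succ, s2]
    simp only [mul_add, add_mul, smul_mul_assoc, mul_assoc, hQ, ← hVQ, mul_zero]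
    module
  have t2 : (a + q) ^ 2 = a * a + (2 : ℂ) • (q * a) := by
    rw [pow_two, two_smul]
    simp only [mul_add, add_mul, hQ', hVQ']
    abel
  have t3 : (a + q) ^ 3 = a * (a * a) + (3 : ℂ) • (q * (a * a)) := by
    rw [pow_succ, t2]
    simp only [mul_add, add_mul, smul_mul_assoc, mul_assoc, r3, hQ', hVQ', mul_zero]
    module
  simp only [Finset.sum_range_succ, Finset.sum_range_zero, s2, s3, t2, t3, pow_zero, pow_one,
    mul_add, add_mul, smul_mul_assoc, mul_smul_comm, mul_assoc, r1, hV, mul_one]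
  norm_num [Nat.choose]
  module

theorem theorem4p1 {H : Type u}
    [NormedAddCommGroup H] [InnerProductSpace ℂ H] [CompleteSpace H]
    (H₀ : Submodule ℂ H) (hH₀ : IsClosed (H₀ : Set H)) (T : H →L[ℂ] H)
    (C₀ : H₀ →L[ℂ] H₀) (C : H₀ᗮ →L[ℂ] H₀) (C₁ : H₀ᗮ →L[ℂ] H₀ᗮ)
    (hT : HasUpperBlockForm T H₀ C₀ C C₁)
    (hC₀ : ‖C₀‖ ≤ 1) (hC₁ : ‖C₁‖ ≤ 1) (hC : C ∘L C₁ = C₀ ∘L C) :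
    ∃ (K : Type u) (_ : NormedAddCommGroup K) (_ : InnerProductSpace ℂ K) (_ : CompleteSpace K)
      (J : H →ₗᵢ[ℂ] K) (S : K →L[ℂ] K),
      IsLifting J T S ∧ IsMIsometric 3 S ∧
        ∃ V Q : K →L[ℂ] K, S = V + Q ∧ Isometry V ∧ Q ^ 2 = 0 ∧ V * Q = Q * V := by
  have : CompleteSpace H₀ := hH₀.completeSpace_coe
  obtain ⟨K₀, K₁, _, _, _, _, _, _, J₀, J₁, V₀, V₁, X, h₀, h₁, hX, hP₀, hP₁, hPX⟩ :=
    exists_intertwining_lifting C₀ C C₁ hC₀ hC₁ fun x => DFunLike.congr_fun hC x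
  let fst := WithLp.fstL 2 ℂ K₀ K₁
  let snd := WithLp.sndL 2 ℂ K₀ K₁
  let V := hilbertPair (V₀ ∘L fst) (V₁ ∘L snd)
  let Q := hilbertPair (X ∘L snd) (0 : WithLp 2 (K₀ × K₁) →L[ℂ] K₁)
  let JJ : WithLp 2 (H₀ × H₀ᗮ) →ₗᵢ[ℂ] WithLp 2 (K₀ × K₁) :=
    { toLinearMap := (hilbertPair (J₀.toContinuousLinearMap ∘L WithLp.fstL 2 ℂ H₀ H₀ᗮ)
        (J₁.toContinuousLinearMap ∘L WithLp.sndL 2 ℂ H₀ H₀ᗮ)).toLinearMap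
      norm_map' := fun x => by
        rw [← sq_eq_sq₀ (norm_nonneg _) (norm_nonneg _), WithLp.prod_norm_sq_eq_of_L2,
          WithLp.prod_norm_sq_eq_of_L2]
        simp }
  let J := JJ.comp H₀.orthogonalDecomposition.toLinearIsometry
  have hJ : ∀ k, projOnto J k = (projOnto J₀ k.fst : H) + (projOnto J₁ k.snd : H) := fun k => by
    refine ext_inner_right ℂ fun x => ?_
    rw [inner_projOnto, inner_add_left]
    have hx : J x = WithLp.toLp 2 (J₀ (H₀.orthogonalProjectionOnto x),
      J₁ (H₀ᗮ.orthogonalProjectionOnto x)) := by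
      simp [J, JJ]
    rw [hx, WithLp.prod_inner_apply]
    simp only [← inner_projOnto]
    simp
  have hVn : ∀ k, ‖V k‖ = ‖k‖ := fun k => by
    rw [← sq_eq_sq₀ (norm_nonneg _) (norm_nonneg _)]
    simp [V, fst, snd, WithLp.prod_norm_sq_eq_of_L2, h₀, h₁]
  have hQ : Q * Q = 0 := by
    ext k; simp [Q, snd]
  have hVQ : V * Q = Q * V := by
    ext k; simp [V, Q, fst, snd, hX]
  refine ⟨WithLp 2 (K₀ × K₁), inferInstance, inferInstance, inferInstance, J, V + Q, ?_,
    isMIsometric_three_of_isometry_add_nilpotent V Q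
      ((ContinuousLinearMap.norm_map_iff_adjoint_comp_self V).1 hVn) hQ hVQ,
    V, Q, rfl, AddMonoidHomClass.isometry_of_norm V hVn, by rw [pow_two, hQ], hVQ⟩
  ext k
  simp only [ContinuousLinearMap.comp_apply, hJ]
  rw [hT]
  simp [V, Q, fst, snd, hP₀, hP₁, hPX]
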